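/- **Proposition 3.1.** Lie groups are real, finite-dimensional, smooth, Hausdorff and second countable. A Lie subgroup of a Lie group $G$ is a subgroup $H\subseteq G$ equipped with a Lie group structure (compatible with its group operations) for which the inclusion $\iota_H : H\hookrightarrow G$ is a smooth immersion; its Lie algebra $\mathfrak h = T_eH$ is regarded as a subspace of $\mathfrak g = T_eG$ through the injective linear map $d(\iota_H)_e$. Let the Lie group $G$ be the Zappa–Szép product of Lie subgroups $H\subseteq G$ and $K\subseteq G$, that is, $G = HK$ and $H\cap K=\{e\}$, and let $\mathfrak g$, $\mathfrak h$ and $\mathfrak k$ be the corresponding Lie algebras. Then $$\mathfrak g = \mathfrak h\oplus\mathfrak k$$ as a direct sum of vector spaces, i.e. $\mathfrak h+\mathfrak k=\mathfrak g$ and $\mathfrak h\cap\mathfrak k=\{0\}$. -/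

import Mathlib

open scoped Manifold ContDiff Pointwise

/-- `G` is the (internal) Zappa–Szép product of its subgroups `H` and `K`:
`G = HK` and `H ∩ K = {e}`. -/
def IsZappaSzepProduct {G : Type*} [Group G] (H K : Subgroup G) : Prop :=
  (H : Set G) * (K : Set G) = Set.univ ∧ (H : Set G) ∩ (K : Set G) = {1}

/-- `H` is a Lie subgroup of the Lie group `G`, its Lie group structure being that of `M`,
carried over to `H` along the bijective homomorphism `ι : M → H`; the inclusion into `G` is an
injective immersion. The topology of `M` may be finer than the one induced from `G` (immersed
Lie subgroups); the case `M = H`, `ι = H.subtype` with the induced topology is that of embedded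
Lie subgroups. `E` and `F` are the finite-dimensional vector spaces on which `G` and `M` are
modelled. -/
structure IsLieSubgroup (E F : Type*) [NormedAddCommGroup E] [NormedSpace ℝ E]
    [NormedAddCommGroup F] [NormedSpace ℝ F]
    {G : Type*} [Group G] [TopologicalSpace G] [ChartedSpace E G]
    {M : Type*} [Group M] [TopologicalSpace M] [ChartedSpace F M]
    (H : Subgroup G) (ι : M →* G) : Prop where
  injective : Function.Injective ι
  range_eq : ι.range = H
  contMDiff : ContMDiff 𝓘(ℝ, F) 𝓘(ℝ, E) ∞ ι
  injective_mfderiv : ∀ x : M, Function.Injective (mfderiv 𝓘(ℝ, F) 𝓘(ℝ, E) ι x)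

/-- The Lie algebra of the Lie subgroup given by `ι : M → G`, as a vector subspace of the Lie
algebra `𝔤 = T₁G`: the image of the Lie algebra `T₁M` under the differential of `ι` at the
identity (note `ι 1 = 1`). -/
noncomputable def lieAlgebraOfSubgroup (E F : Type*) [NormedAddCommGroup E] [NormedSpace ℝ E]
    [NormedAddCommGroup F] [NormedSpace ℝ F]
    {G : Type*} [Group G] [TopologicalSpace G] [ChartedSpace E G]
    {M : Type*} [Group M] [TopologicalSpace M] [ChartedSpace F M]
    (ι : M →* G) : Submodule ℝ (GroupLieAlgebra 𝓘(ℝ, E) G) :=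
  LinearMap.range (M₂ := GroupLieAlgebra 𝓘(ℝ, E) G)
    (mfderiv 𝓘(ℝ, F) 𝓘(ℝ, E) ι (1 : M)).toLinearMap

open scoped Topology
open Module

section Dimension

variable {E : Type*} [NormedAddCommGroup E] [NormedSpace ℝ E] [FiniteDimensional ℝ E]
  {H : Type*} [TopologicalSpace H] {I : ModelWithCorners ℝ E H}
  {M : Type*} [TopologicalSpace M] [ChartedSpace H M]
  {E' : Type*} [NormedAddCommGroup E'] [NormedSpace ℝ E']
  {H' : Type*} [TopologicalSpace H'] {I' : ModelWithCorners ℝ E' H'}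
  {N : Type*} [TopologicalSpace N] [ChartedSpace H' N]

/-! The intersection is trivial by uniqueness of integral curves: a vector common to both Lie
algebras generates local integral curves through the identity in both subgroups. In `G` they follow
the same left-invariant field, so they agree near time 0, lie in `H ∩ K = {e}` and have zero
velocity (`eq_zero_of_mfderiv_eq_of_range_disjoint`). The sum is everything by a dimension count:
multiplication is a smooth surjection from the product of the two subgroups onto `G`, so `dim 𝔤 ≤
dim 𝔥 + dim 𝔨` (`ContMDiff.finrank_le_of_surjective`, via Hausdorff dimension). -/

/-- In a chart of the target, the image of a small neighbourhood under a `C^1` map has Hausdorff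
dimension at most the dimension of the source. -/
theorem ContMDiffAt.exists_nhds_dimH_extChartAt_image_le [I.Boundaryless] [IsManifold I 1 M] [IsManifold I' 1 N]
    {f : M → N} {x : M} {y : N} (hf : ContMDiffAt I I' 1 f x)
    (hy : f x ∈ (chartAt H' y).source) :
    ∃ V ∈ 𝓝 x, dimH ((extChartAt I' y ∘ f) '' V) ≤ finrank ℝ E := by
  have hsmooth : ContDiffAt ℝ 1 (extChartAt I' y ∘ f ∘ (extChartAt I x).symm)
      (extChartAt I x x) := by
    have h := ((contMDiffAt_iff_of_mem_source (mem_chart_source H x) hy).1 hf).2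
    simpa [I.range_eq_univ, contDiffWithinAt_univ] using h
  -- `C^1` maps are locally Lipschitz, and Lipschitz maps do not raise Hausdorff dimension.
  obtain ⟨K, t, ht, hlip⟩ := hsmooth.exists_lipschitzOnWith
  refine ⟨(extChartAt I x).source ∩ extChartAt I x ⁻¹' t,
    Filter.inter_mem (extChartAt_source_mem_nhds x)
      ((continuousAt_extChartAt x).preimage_mem_nhds ht), ?_⟩
  calc dimH ((extChartAt I' y ∘ f) '' ((extChartAt I x).source ∩ extChartAt I x ⁻¹' t))
      ≤ dimH ((extChartAt I' y ∘ f ∘ (extChartAt I x).symm) '' t) := by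
        apply dimH_mono
        rintro _ ⟨z, ⟨hz, hzt⟩, rfl⟩
        exact ⟨extChartAt I x z, hzt, by
          rw [Function.comp_apply, Function.comp_apply, (extChartAt I x).left_inv hz,
            Function.comp_apply]⟩
    _ ≤ dimH t := hlip.dimH_image_le
    _ ≤ dimH (Set.univ : Set E) := dimH_mono (Set.subset_univ t)
    _ = finrank ℝ E := Real.dimH_univ_eq_finrank E

/-- A `C^1` surjection from a second countable manifold does not raise the dimension. -/
theorem ContMDiff.finrank_le_of_surjective [FiniteDimensional ℝ E'] [I.Boundaryless] [I'.Boundaryless]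
    [IsManifold I 1 M] [IsManifold I' 1 N] [SecondCountableTopology M] [Nonempty N] {f : M → N} (hf : ContMDiff I I' 1 f)
    (hsurj : Function.Surjective f) : finrank ℝ E' ≤ finrank ℝ E := by
  obtain ⟨y⟩ := ‹Nonempty N›
  choose! V hV hdim using fun x (hx : x ∈ f ⁻¹' (chartAt H' y).source) ↦
    (hf x).exists_nhds_dimH_extChartAt_image_le (I' := I') hx
  -- Countability is essential: only for countable unions is the Hausdorff dimension the supremum of
  -- those of the pieces.
  obtain ⟨t, hts, htc, hcover⟩ := TopologicalSpace.countable_cover_nhdsWithin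
    fun x hx ↦ mem_nhdsWithin_of_mem_nhds (hV x hx)
  have hsub : (extChartAt I' y).target ⊆ ⋃ x ∈ t, (extChartAt I' y ∘ f) '' V x := by
    intro z hz
    obtain ⟨x, hx⟩ := hsurj ((extChartAt I' y).symm z)
    have hxs : x ∈ f ⁻¹' (chartAt H' y).source := by
      simpa [hx] using (extChartAt I' y).map_target hz
    obtain ⟨i, hi, hxi⟩ := Set.mem_iUnion₂.1 (hcover hxs)
    exact Set.mem_iUnion₂.2 ⟨i, hi, x, hxi, by
      rw [Function.comp_apply, hx, (extChartAt I' y).right_inv hz]⟩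
  have hle := dimH_mono hsub
  rw [Real.dimH_of_mem_nhds (extChartAt_target_mem_nhds y), dimH_bUnion htc] at hle
  exact_mod_cast hle.trans (iSup₂_le fun x hx ↦ hdim x (hts hx))

end Dimension

section InvariantVectorField

variable {E : Type*} [NormedAddCommGroup E] [NormedSpace ℝ E]
  {H : Type*} [TopologicalSpace H] {I : ModelWithCorners ℝ E H}
  {G : Type*} [Group G] [TopologicalSpace G] [ChartedSpace H G]
  {F : Type*} [NormedAddCommGroup F] [NormedSpace ℝ F]
  {H' : Type*} [TopologicalSpace H'] {J : ModelWithCorners ℝ F H'}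
  {M : Type*} [Group M] [TopologicalSpace M] [ChartedSpace H' M]

theorem mulInvariantVectorField_one (v : GroupLieAlgebra J M) :
    mulInvariantVectorField v (1 : M) = (v : F) := by
  -- Abstracting the map allows `(1 * ·)` to be replaced by `id` although the type of the derivative
  -- depends on it.
  have h : ∀ f : M → M, f = id → (mfderiv J J f 1 v : F) = v := by
    rintro _ rfl
    rw [mfderiv_id]
    rfl
  exact h _ (funext one_mul)

variable [LieGroup I ∞ G] [LieGroup J ∞ M]

theorem mdifferentiable_mul_left_of_lieGroup (g : G) : MDifferentiable I I (g * ·) :=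
  (contMDiff_mul_left (I := I) (n := ∞) (a := g)).mdifferentiable (by simp)

/-- A smooth homomorphism relates the left-invariant vector fields generated by a tangent vector at
the identity and by its image. -/
theorem mfderiv_mulInvariantVectorField {ι : M →* G} (hι : ContMDiff J I ∞ ι)
    (v : GroupLieAlgebra J M) (w : GroupLieAlgebra I G)
    (hvw : (mfderiv J I ι 1 v : E) = w) (g : M) :
    mfderiv J I ι g (mulInvariantVectorField v g) = mulInvariantVectorField w (ι g) := by
  have hd : MDifferentiable J I ι := hι.mdifferentiable (by simp)
  -- Both sides are differentiated at the identity by the chain rule.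
  have hcomp : ι ∘ (g * ·) = (ι g * ·) ∘ ι := by ext x; simp
  have h₁ := mfderiv_comp_apply (1 : M) (hd (g * 1))
    (mdifferentiable_mul_left_of_lieGroup (I := J) g 1) v
  have h₂ := mfderiv_comp_apply (1 : M)
    (mdifferentiable_mul_left_of_lieGroup (I := I) (ι g) (ι 1)) (hd 1) v
  rw [hcomp, h₂, mul_one] at h₁
  subst hvw
  rw [map_one] at h₁
  exact h₁.symm

/-- A smooth homomorphism maps integral curves of a left-invariant vector field to integral curves
of the left-invariant vector field generated by the image vector. -/
theorem IsMIntegralCurveAt.map_monoidHom {ι : M →* G} (hι : ContMDiff J I ∞ ι)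
    {v : GroupLieAlgebra J M} {w : GroupLieAlgebra I G}
    (hvw : (mfderiv J I ι 1 v : E) = w) {γ : ℝ → M} {t : ℝ}
    (hγ : IsMIntegralCurveAt γ (mulInvariantVectorField v : (g : M) → TangentSpace J g) t) :
    IsMIntegralCurveAt (ι ∘ γ) (mulInvariantVectorField w : (g : G) → TangentSpace I g) t := by
  filter_upwards [hγ] with s hs
  have h := ((hι.mdifferentiable (by simp)) (γ s)).hasMFDerivAt.comp s hs
  have heq : (mfderiv J I ι (γ s)).comp
      ((1 : ℝ →L[ℝ] ℝ).smulRight (mulInvariantVectorField v (γ s))) =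
      (1 : ℝ →L[ℝ] ℝ).smulRight (mulInvariantVectorField w (ι (γ s))) := by
    apply ContinuousLinearMap.ext
    intro r
    rw [← mfderiv_mulInvariantVectorField hι v w hvw]
    exact map_smul (mfderiv J I ι (γ s)) r _
  exact heq ▸ h

/-- If two Lie group homomorphisms, the first one injective, have images that meet trivially, then a
common value of their differentials at the identity is attained only at zero by the first. -/
theorem eq_zero_of_mfderiv_eq_of_range_disjoint
    [CompleteSpace E] [CompleteSpace F] [I.Boundaryless] [J.Boundaryless]
    {F' : Type*} [NormedAddCommGroup F'] [NormedSpace ℝ F'] [CompleteSpace F']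
    {H'' : Type*} [TopologicalSpace H''] {J' : ModelWithCorners ℝ F' H''} [J'.Boundaryless]
    {M' : Type*} [Group M'] [TopologicalSpace M'] [ChartedSpace H'' M'] [LieGroup J' ∞ M']
    {ι : M →* G} {ι' : M' →* G} (hι : ContMDiff J I ∞ ι) (hι' : ContMDiff J' I ∞ ι')
    (hinj : Function.Injective ι) (hdisj : Disjoint ι.range ι'.range)
    {v : GroupLieAlgebra J M} {v' : GroupLieAlgebra J' M'}
    (hv : (mfderiv J I ι 1 v : E) = (mfderiv J' I ι' 1 v' : E)) : v = 0 := by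
  have hsmooth : minSmoothness ℝ 3 ≤ ∞ := by
    rw [minSmoothness_of_isRCLikeNormedField]
    exact WithTop.coe_le_coe.2 le_top
  have : LieGroup I (minSmoothness ℝ 3) G := .of_le (n := ∞) hsmooth
  have : LieGroup J (minSmoothness ℝ 3) M := .of_le (n := ∞) hsmooth
  have : LieGroup J' (minSmoothness ℝ 3) M' := .of_le (n := ∞) hsmooth
  have : IsManifold I 1 G := .of_le (n := ∞) (by simp)
  have : IsManifold J 1 M := .of_le (n := ∞) (by simp)
  have : IsManifold J' 1 M' := .of_le (n := ∞) (by simp)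
  let w : GroupLieAlgebra I G := (mfderiv J I ι 1 v : E)
  obtain ⟨γ, hγ1, hγ⟩ := exists_isMIntegralCurveAt_of_contMDiffAt_boundaryless (I := J) 0
    ((contMDiffAt_mulInvariantVectorField v (g := (1 : M))).of_le (by simp))
  obtain ⟨γ', hγ1', hγ'⟩ := exists_isMIntegralCurveAt_of_contMDiffAt_boundaryless (I := J') 0
    ((contMDiffAt_mulInvariantVectorField v' (g := (1 : M'))).of_le (by simp))
  have heq : ι ∘ γ =ᶠ[𝓝 0] ι' ∘ γ' :=
    isMIntegralCurveAt_eventuallyEq_of_contMDiffAt_boundaryless (I := I)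
      ((contMDiffAt_mulInvariantVectorField w).of_le (by simp))
      (hγ.map_monoidHom hι (w := w) rfl) (hγ'.map_monoidHom hι' hv.symm) (by simp [hγ1, hγ1'])
  have hconst : γ =ᶠ[𝓝 0] fun _ ↦ 1 := by
    filter_upwards [heq] with t ht
    have h1 : ι (γ t) ∈ ι.range ⊓ ι'.range := ⟨⟨_, rfl⟩, ⟨γ' t, ht.symm⟩⟩
    rw [hdisj.eq_bot, Subgroup.mem_bot] at h1
    exact hinj (h1.trans ι.map_one.symm)
  -- The derivative of `γ` at 0 is given by the field at `γ 0 = 1`, but vanishes because `γ` is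
  -- locally constant.
  have hzero := hasMFDerivAt_unique hγ.hasMFDerivAt
    ((hasMFDerivAt_const (I := 𝓘(ℝ, ℝ)) (I' := J) (1 : M) (0 : ℝ)).congr_of_eventuallyEq hconst)
  have := DFunLike.congr_fun hzero (1 : ℝ)
  have hv0 : mulInvariantVectorField v (γ 0) = 0 := (one_smul ℝ _).symm.trans this
  rw [hγ1] at hv0
  exact (mulInvariantVectorField_one v).symm.trans hv0

end InvariantVectorField

theorem proposition3p1
    {E : Type*} [NormedAddCommGroup E] [NormedSpace ℝ E] [FiniteDimensional ℝ E]
    {G : Type*} [Group G] [TopologicalSpace G] [ChartedSpace E G] [LieGroup 𝓘(ℝ, E) ∞ G]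
    [T2Space G] [SecondCountableTopology G]
    {E₁ : Type*} [NormedAddCommGroup E₁] [NormedSpace ℝ E₁] [FiniteDimensional ℝ E₁]
    {M₁ : Type*} [Group M₁] [TopologicalSpace M₁] [ChartedSpace E₁ M₁]
    [LieGroup 𝓘(ℝ, E₁) ∞ M₁] [T2Space M₁] [SecondCountableTopology M₁]
    {E₂ : Type*} [NormedAddCommGroup E₂] [NormedSpace ℝ E₂] [FiniteDimensional ℝ E₂]
    {M₂ : Type*} [Group M₂] [TopologicalSpace M₂] [ChartedSpace E₂ M₂]
    [LieGroup 𝓘(ℝ, E₂) ∞ M₂] [T2Space M₂] [SecondCountableTopology M₂]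
    (H K : Subgroup G) (ιH : M₁ →* G) (ιK : M₂ →* G)
    (hH : IsLieSubgroup E E₁ H ιH) (hK : IsLieSubgroup E E₂ K ιK)
    (hG : IsZappaSzepProduct H K) :
    IsCompl (lieAlgebraOfSubgroup E E₁ ιH) (lieAlgebraOfSubgroup E E₂ ιK) := by
  have : IsManifold 𝓘(ℝ, E) 1 G := .of_le (n := ∞) (by simp)
  have : IsManifold 𝓘(ℝ, E₁) 1 M₁ := .of_le (n := ∞) (by simp)
  have : IsManifold 𝓘(ℝ, E₂) 1 M₂ := .of_le (n := ∞) (by simp)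
  have : CompleteSpace E := FiniteDimensional.complete ℝ E
  have : CompleteSpace E₁ := FiniteDimensional.complete ℝ E₁
  have : CompleteSpace E₂ := FiniteDimensional.complete ℝ E₂
  have : FiniteDimensional ℝ (GroupLieAlgebra 𝓘(ℝ, E) G) := ‹FiniteDimensional ℝ E›
  obtain ⟨hprod, hinter⟩ := hG
  have hsurj : Function.Surjective fun p : M₁ × M₂ ↦ ιH p.1 * ιK p.2 := by
    intro g
    obtain ⟨h, hh, k, hk, rfl⟩ := Set.mem_mul.1 (hprod ▸ Set.mem_univ g)
    rw [← hH.range_eq] at hh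
    rw [← hK.range_eq] at hk
    obtain ⟨x, rfl⟩ := hh
    obtain ⟨y, rfl⟩ := hk
    exact ⟨(x, y), rfl⟩
  have hsmooth : ContMDiff (𝓘(ℝ, E₁).prod 𝓘(ℝ, E₂)) 𝓘(ℝ, E) 1
      fun p : M₁ × M₂ ↦ ιH p.1 * ιK p.2 :=
    ((hH.contMDiff.comp contMDiff_fst).mul (hK.contMDiff.comp contMDiff_snd)).of_le (by simp)
  have hdim : finrank ℝ E ≤ finrank ℝ E₁ + finrank ℝ E₂ := by
    simpa using hsmooth.finrank_le_of_surjective hsurj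
  have hfinrank₁ : finrank ℝ (lieAlgebraOfSubgroup E E₁ ιH) = finrank ℝ E₁ :=
    LinearMap.finrank_range_of_inj (hH.injective_mfderiv 1)
  have hfinrank₂ : finrank ℝ (lieAlgebraOfSubgroup E E₂ ιK) = finrank ℝ E₂ :=
    LinearMap.finrank_range_of_inj (hK.injective_mfderiv 1)
  -- Given the dimension bound, disjointness alone forces the sum to be all of `𝔤`.
  refine (Submodule.isCompl_iff_disjoint _ _ ?_).2 ?_
  · rw [hfinrank₁, hfinrank₂]
    exact hdim
  · have hdisj : Disjoint ιH.range ιK.range := by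
      rw [hH.range_eq, hK.range_eq, Subgroup.disjoint_def]
      exact fun {x} hx hx' ↦ by simpa using hinter.subset ⟨hx, hx'⟩
    rw [Submodule.disjoint_def]
    rintro _ ⟨v, rfl⟩ ⟨v', hv'⟩
    have hv : v = 0 := eq_zero_of_mfderiv_eq_of_range_disjoint (I := 𝓘(ℝ, E))
      hH.contMDiff hK.contMDiff hH.injective hdisj hv'.symm
    subst hv
    exact map_zero (mfderiv 𝓘(ℝ, E₁) 𝓘(ℝ, E) ιH 1)
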